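/- **Setting.** Let $n_{\rm a}\ge 1$, $n_{\rm b}\ge 0$, $n_{\rm r}=\max(n_{\rm a},n_{\rm b})$, let $\mathbb P\subseteq\mathbb R^{n_{\rm p}}$ be convex and compact, and let $\mathscr P\subseteq\mathbb P^{\mathbb N}$ ($\mathbb N=\{1,2,\dots\}$) be the set of admissible scheduling trajectories; $\mathscr P_{[1,L]}$ is the set of their truncations to $\{1,\dots,L\}$. Consider the shifted-affine LPV system $$y_k+\sum_{i=1}^{n_{\rm a}}a_i(p_{k-i})\,y_{k-i}=\sum_{i=0}^{n_{\rm b}}b_i(p_{k-i})\,u_{k-i},\qquad k\in\mathbb N, \tag{1}$$ with $u_k\in\mathbb R^{n_{\rm u}}$, $y_k\in\mathbb R^{n_{\rm y}}$, where $a_i(p)=a_{i,0}+\sum_{j=1}^{n_{\rm p}}a_{i,j}p_j$ and $b_i(p)=b_{i,0}+\sum_{j=1}^{n_{\rm p}}b_{i,j}p_j$ are matrix valued and affine. An initial condition $w_0$ consists of past outputs $\{y_k\}_{k=1-n_{\rm a}}^{0}$, past inputs $\{u_k\}_{k=1-n_{\rm b}}^{0}$ and past scheduling values $\{p_k\}_{k=1-n_{\rm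 r}}^{0}$ in $\mathbb P$; it is zero if the past inputs and outputs are zero. The behavior $\mathfrak B$ is the set of all $(u,p,y)\in(\mathbb R^{n_{\rm u}}\times\mathbb P\times\mathbb R^{n_{\rm y}})^{\mathbb N}$ with $p\in\mathscr P$ that satisfy (1) for some initial condition, and $\mathfrak B|_{[1,N]}$ is the set of truncations to $\{1,\dots,N\}$. The system order $n_{\rm x}$ is the minimal $n$ for which there are matrix functions $A,B,C,D$ on $\mathbb R^{n_{\rm p}}$ such that $(u,p,y)\in\mathfrak B$ if and only if $p\in\mathscr P$ and there is $x:\mathbb N\to\mathbb R^{n}$ with $x_{k+1}=A(p_k)x_k+B(p_k)u_k$, $y_k=C(p_k)x_k+D(p_k)u_k$ for all $k\in\mathbb N$. Let $Q=Q^\top\in\mathbb R^{n_{\rm u}\times n_{\rm u}}$, $S\in\mathbb R^{n_{\rm u}\times n_{\rm y}}$, $R=R^\top\in\mathbb R^{n_{\rm y}\times n_{\rm y}}$ and $\Pi=\begin{bmatrix}Q&S\\S^\top&R\end{bmatrix}$. The system is *$L$-dissipative* with respect to $(Q,S,R)$ if $\sum_{k=1}^{r}\begin{bmatrix}u_k\\y_k\end{bmatrix}^{\top}\Pi\begin{bmatrix}u_k\\y_k\end{bmatrix}\ge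 0$ for every $r\in\{1,\dots,L\}$ and every trajectory $(u,p,y)\in\mathfrak B$ with zero initial condition. Let $1\le L\le N$ and let $(u_{[1,N]},p_{[1,N]},y_{[1,N]})\in\mathfrak B|_{[1,N]}$ be a data set. For a sequence $w_{[1,N]}$ let $\mathcal H_L(w)$ be its Hankel matrix of depth $L$, with block entries $w_{i+j-1}$, $1\le i\le L$, $1\le j\le N-L+1$; let $u^{\mathtt p}=\{p_k\otimes u_k\}_{k=1}^N$, $y^{\mathtt p}=\{p_k\otimes y_k\}_{k=1}^N$. For $\bar p\in\mathscr P_{[1,L]}$ let $\bar{\mathcal P}^{n}$ be the block-diagonal matrix with diagonal blocks $\bar p_i\otimes I_n$, $i=1,\dots,L$. Put $$H=\begin{bmatrix}\mathcal H_L(u)\\ \mathcal H_L(y)\end{bmatrix},\quad \Pi_H=H^\top\begin{bmatrix}I_L\otimes Q&I_L\otimes S\\ I_L\otimes S^\top&I_L\otimes R\end{bmatrix}H,\quad F_2(\bar p)=\begin{bmatrix}\mathcal H_L(u^{\mathtt p})-\bar{\mathcal P}^{n_{\rm u}}\mathcal H_L(u)\\ \mathcal H_L(y^{\mathtt p})-\bar{\mathcal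 P}^{n_{\rm y}}\mathcal H_L(y)\end{bmatrix},\quad F(\bar p)=\begin{bmatrix}V_\ell H\\F_2(\bar p)\end{bmatrix},$$ where $V_\ell$ selects the first $\ell$ input samples and the first $\ell$ output samples of a stacked trajectory of length $L$. The data set is *persistently exciting* of degree $(L,n_{\rm x})$ if for every $\bar p\in\mathscr P_{[1,L]}$ the orthogonal projection of the row space of $H$ onto the null space of $F_2(\bar p)$ has dimension $n_{\rm x}+n_{\rm u}L$. **Theorem.** (i) If the system is $L$-dissipative with respect to $(Q,S,R)$, then for every $\ell$ with $n_{\rm r}\le\ell<L$ and every $\bar p\in\mathscr P_{[1,L]}$, $$g^\top\Pi_H\,g\ge 0\quad\text{for all } g\in\mathbb R^{N-L+1}\text{ with }F(\bar p)g=0. \tag{2}$$ (ii) Conversely, suppose that every admissible scheduling trajectory is the tail of an admissible one (for each $p\in\mathscr P$ there is $p'\in\mathscr P$ with $p'_{k+1}=p_k$ for all $k\in\mathbb N$; for instance $\mathscr P=\mathbb P^{\mathbb N}$), that the system has a finite order $n_{\rm x}$, and that the data set is persistently exciting of degree $(L,n_{\rm x})$. If for some $0\le\ell<L$ condition (2)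 holds for all $\bar p\in\mathscr P_{[1,L]}$, then the system is $(L-\ell)$-dissipative with respect to $(Q,S,R)$. -/

import Mathlib

open scoped Matrix Kronecker

/- Discrete time `1, 2, 3, …` is indexed by `ℕ` or `Fin` starting from `0`: the entry with index `k`
of a signal is its value at time `k + 1`. -/

namespace LPV

noncomputable section

/-- The affine matrix function `p ↦ ∑_{j=0}^{n_p} c_j p_j`, where `p_0 = 1`. -/
def affine {np : ℕ} {m n : Type} (c : Fin (np + 1) → Matrix m n ℝ) (p : Fin np → ℝ) :
    Matrix m n ℝ :=
  ∑ j : Fin (np + 1), (Fin.cons (1 : ℝ) p : Fin (np + 1) → ℝ) j • c j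

/-- A shifted-affine LPV input-output representation
`y_k + ∑_{i=1}^{na} a_i(p_{k-i}) y_{k-i} = ∑_{i=0}^{nb} b_i(p_{k-i}) u_{k-i}`
with affine coefficient functions, scheduling space `PSpace`, and set `Sched` of admissible
scheduling trajectories. The coefficients of `a_i` are `a (i - 1)`, those of `b_i` are `b i`. -/
structure System (nu ny np : ℕ) where
  na : ℕ
  nb : ℕ
  one_le_na : 1 ≤ na
  a : Fin na → Fin (np + 1) → Matrix (Fin ny) (Fin ny) ℝ
  b : Fin (nb + 1) → Fin (np + 1) → Matrix (Fin ny) (Fin nu) ℝ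
  PSpace : Set (Fin np → ℝ)
  convex_PSpace : Convex ℝ PSpace
  compact_PSpace : IsCompact PSpace
  Sched : Set (ℕ → Fin np → ℝ)
  sched_mem : ∀ p ∈ Sched, ∀ k, p k ∈ PSpace

/-- The signal on `ℤ` with values `s` at the times `1, 2, …` and `past i` at the times `-i`,
`i = 0, …, n - 1`; the value `0` at the remaining times is never used. -/
def prepend {n d : ℕ} (past : Fin n → Fin d → ℝ) (s : ℕ → Fin d → ℝ) (k : ℤ) : Fin d → ℝ :=
  if 1 ≤ k then s (k - 1).toNat
  else if h : (-k).toNat < n then past ⟨(-k).toNat, h⟩ else 0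

namespace System

variable {nu ny np : ℕ}

/-- `n_r = max(n_a, n_b)`. -/
def nr (G : System nu ny np) : ℕ := max G.na G.nb

/-- Initial conditions `w_0`: entry `i` is the value at time `-i`. -/
structure InitCond (G : System nu ny np) where
  u : Fin G.nb → Fin nu → ℝ
  p : Fin G.nr → Fin np → ℝ
  y : Fin G.na → Fin ny → ℝ
  p_mem : ∀ i, p i ∈ G.PSpace

/-- Zero initial condition: the past inputs and outputs vanish. -/
def InitCond.IsZero {G : System nu ny np} (w : G.InitCond) : Prop := w.u = 0 ∧ w.y = 0

/-- `(u, p, y)` is a trajectory of the system with initial condition `w`. -/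
def IsTrajectory (G : System nu ny np) (w : G.InitCond)
    (u : ℕ → Fin nu → ℝ) (p : ℕ → Fin np → ℝ) (y : ℕ → Fin ny → ℝ) : Prop :=
  p ∈ G.Sched ∧ ∀ k : ℤ, 1 ≤ k →
    prepend w.y y k +
      ∑ i : Fin G.na, affine (G.a i) (prepend w.p p (k - ((i : ℕ) + 1))) *ᵥ
        prepend w.y y (k - ((i : ℕ) + 1))
    = ∑ i : Fin (G.nb + 1), affine (G.b i) (prepend w.p p (k - (i : ℕ))) *ᵥ
        prepend w.u u (k - (i : ℕ))

/-- The behavior of the system. -/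
def behavior (G : System nu ny np) :
    Set ((ℕ → Fin nu → ℝ) × (ℕ → Fin np → ℝ) × (ℕ → Fin ny → ℝ)) :=
  {t | ∃ w : G.InitCond, G.IsTrajectory w t.1 t.2.1 t.2.2}

/-- The behavior restricted to the times `1, …, N`. -/
def behaviorOn (G : System nu ny np) (N : ℕ) :
    Set ((Fin N → Fin nu → ℝ) × (Fin N → Fin np → ℝ) × (Fin N → Fin ny → ℝ)) :=
  {t | ∃ s ∈ G.behavior, ∀ k : Fin N,
    t.1 k = s.1 k ∧ t.2.1 k = s.2.1 k ∧ t.2.2 k = s.2.2 k}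

/-- The admissible scheduling trajectories restricted to the times `1, …, L`. -/
def schedOn (G : System nu ny np) (L : ℕ) : Set (Fin L → Fin np → ℝ) :=
  {pbar | ∃ p ∈ G.Sched, ∀ k : Fin L, pbar k = p k}

/-- Every admissible scheduling trajectory is the tail of an admissible one: the set of admissible
scheduling trajectories is contained in its own image under the left shift. -/
def SchedSubsetShift (G : System nu ny np) : Prop :=
  ∀ p ∈ G.Sched, ∃ p' ∈ G.Sched, ∀ k, p' (k + 1) = p k

/-- The LPV state-space representation `x_{k+1} = A(p_k) x_k + B(p_k) u_k`,
`y_k = C(p_k) x_k + D(p_k) u_k` of state dimension `n` represents the behavior of the system. -/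
def IsRealizedBy (G : System nu ny np) (n : ℕ)
    (A : (Fin np → ℝ) → Matrix (Fin n) (Fin n) ℝ) (B : (Fin np → ℝ) → Matrix (Fin n) (Fin nu) ℝ)
    (C : (Fin np → ℝ) → Matrix (Fin ny) (Fin n) ℝ)
    (D : (Fin np → ℝ) → Matrix (Fin ny) (Fin nu) ℝ) : Prop :=
  ∀ (u : ℕ → Fin nu → ℝ) (p : ℕ → Fin np → ℝ) (y : ℕ → Fin ny → ℝ),
    (u, p, y) ∈ G.behavior ↔
      p ∈ G.Sched ∧ ∃ x : ℕ → Fin n → ℝ, ∀ k,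
        x (k + 1) = A (p k) *ᵥ x k + B (p k) *ᵥ u k ∧ y k = C (p k) *ᵥ x k + D (p k) *ᵥ u k

/-- `n` is the system order: the minimal state dimension of an LPV state-space realization. -/
def IsOrder (G : System nu ny np) (n : ℕ) : Prop :=
  IsLeast {m : ℕ | ∃ A B C D, G.IsRealizedBy m A B C D} n

end System

variable {nu ny np N L : ℕ}

/-- The supply rate matrix `Π = [Q S; Sᵀ R]`. -/
def supplyMatrix (Q : Matrix (Fin nu) (Fin nu) ℝ) (S : Matrix (Fin nu) (Fin ny) ℝ)
    (R : Matrix (Fin ny) (Fin ny) ℝ) : Matrix (Fin nu ⊕ Fin ny) (Fin nu ⊕ Fin ny) ℝ :=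
  Matrix.fromBlocks Q S Sᵀ R

/-- `[u; y]ᵀ Π [u; y]`. -/
def supply (Q : Matrix (Fin nu) (Fin nu) ℝ) (S : Matrix (Fin nu) (Fin ny) ℝ)
    (R : Matrix (Fin ny) (Fin ny) ℝ) (u : Fin nu → ℝ) (y : Fin ny → ℝ) : ℝ :=
  Sum.elim u y ⬝ᵥ (supplyMatrix Q S R *ᵥ Sum.elim u y)

/-- `L`-dissipativity with respect to `(Q, S, R)`: the dissipation inequality over the times
`1, …, r`, for every `1 ≤ r ≤ L`, along all trajectories with zero initial condition
(only the first `L` samples of the trajectory enter). -/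
def System.IsDissipative (G : System nu ny np) (L : ℕ) (Q : Matrix (Fin nu) (Fin nu) ℝ)
    (S : Matrix (Fin nu) (Fin ny) ℝ) (R : Matrix (Fin ny) (Fin ny) ℝ) : Prop :=
  ∀ (w : G.InitCond) (u : ℕ → Fin nu → ℝ) (p : ℕ → Fin np → ℝ) (y : ℕ → Fin ny → ℝ),
    w.IsZero → G.IsTrajectory w u p y →
      ∀ r : ℕ, 1 ≤ r → r ≤ L → 0 ≤ ∑ k ∈ Finset.range r, supply Q S R (u k) (y k)

/-- The Hankel matrix of depth `L` of a sequence of length `N`. -/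
def hankel {m : Type} (h : L ≤ N) (w : Fin N → m → ℝ) :
    Matrix (Fin L × m) (Fin (N - L + 1)) ℝ :=
  Matrix.of fun i j => w ⟨i.1 + j, by omega⟩ i.2

/-- The sequence of Kronecker products `p_k ⊗ w_k`. -/
def kronSeq {d : ℕ} (p : Fin N → Fin np → ℝ) (w : Fin N → Fin d → ℝ) :
    Fin N → Fin np × Fin d → ℝ :=
  fun k i => p k i.1 * w k i.2

/-- The block-diagonal matrix with the diagonal blocks `p_1 ⊗ I_d, …, p_L ⊗ I_d`. -/
def schedBlock (d : ℕ) (p : Fin L → Fin np → ℝ) :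
    Matrix (Fin L × (Fin np × Fin d)) (Fin L × Fin d) ℝ :=
  Matrix.of fun r c => if r.1 = c.1 then p r.1 r.2.1 * (1 : Matrix (Fin d) (Fin d) ℝ) r.2.2 c.2
    else 0

/-- `[H_L(u); H_L(y)]`. -/
def ioHankel (h : L ≤ N) (u : Fin N → Fin nu → ℝ) (y : Fin N → Fin ny → ℝ) :
    Matrix ((Fin L × Fin nu) ⊕ (Fin L × Fin ny)) (Fin (N - L + 1)) ℝ :=
  Matrix.fromRows (hankel h u) (hankel h y)

/-- The matrix `[I 0]` that selects the first `ℓ` samples of a vectorized sequence of length `L`. -/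
def firstSamples (ℓ L d : ℕ) : Matrix (Fin ℓ × Fin d) (Fin L × Fin d) ℝ :=
  Matrix.of fun r c => if (r.1 : ℕ) = (c.1 : ℕ) ∧ r.2 = c.2 then 1 else 0

/-- The matrix `V_ℓ`, which selects the first `ℓ` input and the first `ℓ` output samples. -/
def V (ℓ L nu ny : ℕ) :
    Matrix ((Fin ℓ × Fin nu) ⊕ (Fin ℓ × Fin ny)) ((Fin L × Fin nu) ⊕ (Fin L × Fin ny)) ℝ :=
  Matrix.fromBlocks (firstSamples ℓ L nu) 0 0 (firstSamples ℓ L ny)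

/-- `Π_L`. -/
def PiL (L : ℕ) (Q : Matrix (Fin nu) (Fin nu) ℝ) (S : Matrix (Fin nu) (Fin ny) ℝ)
    (R : Matrix (Fin ny) (Fin ny) ℝ) :
    Matrix ((Fin L × Fin nu) ⊕ (Fin L × Fin ny)) ((Fin L × Fin nu) ⊕ (Fin L × Fin ny)) ℝ :=
  Matrix.fromBlocks ((1 : Matrix (Fin L) (Fin L) ℝ) ⊗ₖ Q) ((1 : Matrix (Fin L) (Fin L) ℝ) ⊗ₖ S)
    ((1 : Matrix (Fin L) (Fin L) ℝ) ⊗ₖ Sᵀ) ((1 : Matrix (Fin L) (Fin L) ℝ) ⊗ₖ R)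

/-- `Π_H = [H_L(u); H_L(y)]ᵀ Π_L [H_L(u); H_L(y)]`. -/
def PiH (h : L ≤ N) (u : Fin N → Fin nu → ℝ) (y : Fin N → Fin ny → ℝ)
    (Q : Matrix (Fin nu) (Fin nu) ℝ) (S : Matrix (Fin nu) (Fin ny) ℝ)
    (R : Matrix (Fin ny) (Fin ny) ℝ) : Matrix (Fin (N - L + 1)) (Fin (N - L + 1)) ℝ :=
  (ioHankel h u y)ᵀ * PiL L Q S R * ioHankel h u y

/-- `F₂(p̄)`: the constraints imposed by the scheduling trajectory `p̄`. -/
def F₂ (h : L ≤ N) (u : Fin N → Fin nu → ℝ) (p : Fin N → Fin np → ℝ) (y : Fin N → Fin ny → ℝ)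
    (pbar : Fin L → Fin np → ℝ) :
    Matrix ((Fin L × (Fin np × Fin nu)) ⊕ (Fin L × (Fin np × Fin ny))) (Fin (N - L + 1)) ℝ :=
  Matrix.fromRows (hankel h (kronSeq p u) - schedBlock nu pbar * hankel h u)
    (hankel h (kronSeq p y) - schedBlock ny pbar * hankel h y)

/-- `F(p̄) = [V_ℓ [H_L(u); H_L(y)]; F₂(p̄)]`. -/
def F (ℓ : ℕ) (h : L ≤ N) (u : Fin N → Fin nu → ℝ) (p : Fin N → Fin np → ℝ)
    (y : Fin N → Fin ny → ℝ) (pbar : Fin L → Fin np → ℝ) :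
    Matrix (((Fin ℓ × Fin nu) ⊕ (Fin ℓ × Fin ny)) ⊕
      ((Fin L × (Fin np × Fin nu)) ⊕ (Fin L × (Fin np × Fin ny)))) (Fin (N - L + 1)) ℝ :=
  Matrix.fromRows (V ℓ L nu ny * ioHankel h u y) (F₂ h u p y pbar)

/-- `gᵀ Π_H g ≥ 0` for all `g` with `F(p̄) g = 0`. -/
def DataCondition (ℓ : ℕ) (h : L ≤ N) (u : Fin N → Fin nu → ℝ) (p : Fin N → Fin np → ℝ)
    (y : Fin N → Fin ny → ℝ) (Q : Matrix (Fin nu) (Fin nu) ℝ) (S : Matrix (Fin nu) (Fin ny) ℝ)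
    (R : Matrix (Fin ny) (Fin ny) ℝ) (pbar : Fin L → Fin np → ℝ) : Prop :=
  ∀ g : Fin (N - L + 1) → ℝ, F ℓ h u p y pbar *ᵥ g = 0 → 0 ≤ g ⬝ᵥ (PiH h u y Q S R *ᵥ g)

/-- The null space of `F₂(p̄)`. -/
def nullSpace (h : L ≤ N) (u : Fin N → Fin nu → ℝ) (p : Fin N → Fin np → ℝ)
    (y : Fin N → Fin ny → ℝ) (pbar : Fin L → Fin np → ℝ) :
    Submodule ℝ (EuclideanSpace ℝ (Fin (N - L + 1))) :=
  LinearMap.ker (Matrix.toEuclideanLin (F₂ h u p y pbar))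

/-- The row space of `[H_L(u); H_L(y)]`. -/
def rowSpace (h : L ≤ N) (u : Fin N → Fin nu → ℝ) (y : Fin N → Fin ny → ℝ) :
    Submodule ℝ (EuclideanSpace ℝ (Fin (N - L + 1))) :=
  Submodule.span ℝ (Set.range fun r => WithLp.toLp 2 (ioHankel h u y r))

/-- The data set is persistently exciting of degree `(L, nx)`: for every admissible `p̄`, the
orthogonal projection of the row space onto the null space has dimension `nx + nu L`. -/
def IsPersistentlyExciting (G : System nu ny np) (nx : ℕ) (h : L ≤ N)
    (u : Fin N → Fin nu → ℝ) (p : Fin N → Fin np → ℝ) (y : Fin N → Fin ny → ℝ) : Prop :=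
  ∀ pbar ∈ G.schedOn L,
    Module.finrank ℝ ((rowSpace h u y).map
      ((nullSpace h u p y pbar).starProjection : EuclideanSpace ℝ (Fin (N - L + 1)) →ₗ[ℝ]
        EuclideanSpace ℝ (Fin (N - L + 1)))) = nx + nu * L

end

end LPV

/-!
Write `resid k` for the difference of the two sides of the system equation at time `k`. The
coefficients are affine in the scheduling signal, so `resid k` is a *linear* functional of the
lifted signals `(1, p_k) ⊗ y_k` and `(1, p_k) ⊗ u_k` (`LPV.System.resid`). Each data window
satisfies the system equations, hence so does every linear combination of the lifted windows, and
`F₂(p̄) g = 0` says exactly that, inside the window, the combination with the weights `g` is the lift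
along `p̄` of the signals `H g` (`LPV.sum_window`).

If, moreover, `H g` vanishes at the first `ℓ ≥ nr` times, the pasts of the windows do not enter the
equations at the later times, and `H g` is the beginning of a trajectory along `p̄` with zero initial
condition. Since `gᵀ Π_H g` is its total supply, dissipativity implies the data condition
(`LPV.System.IsDissipative.dataCondition`).

For the converse, a state-space realization of order `nx` places the trajectories of length `L`
along a fixed `p̄` in a linear space of dimension at most `nx + nu L`, the range of `LPV.ioMap`. This
space contains `H g` for all `g` in the null space of `F₂(p̄)`
(`LPV.System.IsRealizedBy.ioHankel_mulVec_mem_range`), and by persistency of excitation the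
vectors `H g` span a space of dimension at least `nx + nu L`
(`LPV.finrank_map_starProjection_le`). So the data generate all trajectories of length `L`. Given a
trajectory of length `r ≤ L - ℓ` with zero initial condition, the admissible scheduling signals allow
it to be preceded by `L - r ≥ ℓ` zeros; the data condition for the resulting trajectory is the
dissipation inequality (`LPV.System.IsRealizedBy.isDissipative`).
-/

namespace LPV

variable {nu ny np N L d : ℕ}

/-! ### Lifted signals and the residual of the difference equation -/

/-- The signal `(1, p_k) ⊗ x_k` on `ℤ`: the affine dependence on the scheduling signal becomes a
linear dependence on the lifted signal. -/
noncomputable def lift (P : ℤ → Fin np → ℝ) (X : ℤ → Fin d → ℝ) (k : ℤ) (j : Fin (np + 1)) :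
    Fin d → ℝ :=
  (Fin.cons (1 : ℝ) (P k) : Fin (np + 1) → ℝ) j • X k

theorem lift_eq_zero (P : ℤ → Fin np → ℝ) {X : ℤ → Fin d → ℝ} {k : ℤ} (h : X k = 0) :
    lift P X k = 0 := by
  funext j
  simp [lift, h]

theorem lift_congr {P P' : ℤ → Fin np → ℝ} {X X' : ℤ → Fin d → ℝ} {k m : ℤ} (hP : P k = P' m)
    (hX : X k = X' m) : lift P X k = lift P' X' m := by
  funext j
  simp [lift, hP, hX]

theorem affine_mulVec {m : ℕ} (c : Fin (np + 1) → Matrix (Fin m) (Fin d) ℝ)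
    (P : ℤ → Fin np → ℝ) (X : ℤ → Fin d → ℝ) (k : ℤ) :
    affine c (P k) *ᵥ X k = ∑ j, c j *ᵥ lift P X k j := by
  simp only [affine, lift, Matrix.sum_mulVec, Matrix.smul_mulVec, Matrix.mulVec_smul]

/-- The pair of the lifted output and the lifted input. -/
noncomputable def liftPair (P : ℤ → Fin np → ℝ) (U : ℤ → Fin nu → ℝ) (Y : ℤ → Fin ny → ℝ) :
    (ℤ → Fin (np + 1) → Fin ny → ℝ) × (ℤ → Fin (np + 1) → Fin nu → ℝ) :=
  (lift P Y, lift P U)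

namespace System

/-- The difference between the two sides of the system equation at time `k`, as a linear map on
pairs of lifted output and input signals. -/
noncomputable def resid (G : System nu ny np) (k : ℤ) :
    ((ℤ → Fin (np + 1) → Fin ny → ℝ) × (ℤ → Fin (np + 1) → Fin nu → ℝ)) →ₗ[ℝ] (Fin ny → ℝ) where
  toFun t := t.1 k 0 + ∑ i : Fin G.na, ∑ j, G.a i j *ᵥ t.1 (k - ((i : ℕ) + 1)) j -
    ∑ i : Fin (G.nb + 1), ∑ j, G.b i j *ᵥ t.2 (k - (i : ℕ)) j
  map_add' s t := by
    simp only [Prod.fst_add, Prod.snd_add, Pi.add_apply, Matrix.mulVec_add, Finset.sum_add_distrib]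
    abel
  map_smul' c t := by
    simp only [Prod.smul_fst, Prod.smul_snd, Pi.smul_apply, Matrix.mulVec_smul, RingHom.id_apply,
      ← Finset.smul_sum, smul_sub, smul_add]

theorem resid_apply (G : System nu ny np) (k : ℤ)
    (t : (ℤ → Fin (np + 1) → Fin ny → ℝ) × (ℤ → Fin (np + 1) → Fin nu → ℝ)) :
    G.resid k t = t.1 k 0 + ∑ i : Fin G.na, ∑ j, G.a i j *ᵥ t.1 (k - ((i : ℕ) + 1)) j -
      ∑ i : Fin (G.nb + 1), ∑ j, G.b i j *ᵥ t.2 (k - (i : ℕ)) j := rfl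

/-- Only the times `k - na, …, k` of the output and `k - nb, …, k` of the input enter the equation
at time `k`, which is otherwise invariant under time shifts. -/
theorem resid_congr (G : System nu ny np) {k k' : ℤ}
    {t t' : (ℤ → Fin (np + 1) → Fin ny → ℝ) × (ℤ → Fin (np + 1) → Fin nu → ℝ)}
    (h₁ : ∀ i : ℤ, 0 ≤ i → i ≤ G.na → t.1 (k - i) = t'.1 (k' - i))
    (h₂ : ∀ i : ℤ, 0 ≤ i → i ≤ G.nb → t.2 (k - i) = t'.2 (k' - i)) :
    G.resid k t = G.resid k' t' := by
  have h0 := h₁ 0 le_rfl (by omega)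
  simp only [sub_zero] at h0
  rw [resid_apply, resid_apply, h0]
  congr 1
  · congr 1
    refine Finset.sum_congr rfl fun i _ => ?_
    rw [h₁ _ (by omega) (by omega)]
  · refine Finset.sum_congr rfl fun i _ => ?_
    rw [h₂ _ (by omega) (by omega)]

theorem resid_liftPair (G : System nu ny np) (P : ℤ → Fin np → ℝ) (U : ℤ → Fin nu → ℝ)
    (Y : ℤ → Fin ny → ℝ) (k : ℤ) :
    G.resid k (liftPair P U Y) =
      Y k + ∑ i : Fin G.na, affine (G.a i) (P (k - ((i : ℕ) + 1))) *ᵥ Y (k - ((i : ℕ) + 1)) -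
        ∑ i : Fin (G.nb + 1), affine (G.b i) (P (k - (i : ℕ))) *ᵥ U (k - (i : ℕ)) := by
  simp only [resid_apply, affine_mulVec, liftPair]
  simp [lift]

theorem isTrajectory_iff {G : System nu ny np} {w : G.InitCond} {u : ℕ → Fin nu → ℝ}
    {p : ℕ → Fin np → ℝ} {y : ℕ → Fin ny → ℝ} :
    G.IsTrajectory w u p y ↔ p ∈ G.Sched ∧ ∀ k : ℤ, 1 ≤ k →
      G.resid k (liftPair (prepend w.p p) (prepend w.u u) (prepend w.y y)) = 0 := by
  simp only [IsTrajectory, resid_liftPair, sub_eq_zero]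

end System

/-! ### Existence of trajectories -/

theorem prepend_of_pos {n : ℕ} (past : Fin n → Fin d → ℝ) (s : ℕ → Fin d → ℝ) (k : ℕ) :
    prepend past s ((k : ℤ) + 1) = s k := by
  rw [prepend, if_pos (by omega)]
  congr 1
  omega

theorem prepend_of_nonpos {n : ℕ} (past : Fin n → Fin d → ℝ) (s : ℕ → Fin d → ℝ) (i : Fin n) :
    prepend past s (-(i : ℤ)) = past i := by
  rw [prepend, if_neg (by omega), dif_pos (by omega)]
  simp

theorem prepend_eq_zero {n : ℕ} (s : ℕ → Fin d → ℝ) {k : ℤ} (hk : k ≤ 0) :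
    prepend (0 : Fin n → Fin d → ℝ) s k = 0 := by
  rw [prepend, if_neg (by omega)]
  split <;> rfl

theorem prepend_congr {n : ℕ} (past : Fin n → Fin d → ℝ) {s s' : ℕ → Fin d → ℝ} {k : ℤ}
    (h : ∀ j : ℕ, (j : ℤ) < k → s j = s' j) : prepend past s k = prepend past s' k := by
  unfold prepend
  split
  · exact h _ (by omega)
  · rfl

/-- A recursion in which the value at `k` depends only on the earlier values has a solution. -/
theorem exists_causal_fixedPoint {E : Type*} [Inhabited E] (f : ℕ → (ℕ → E) → E)
    (hf : ∀ k s s', (∀ j < k, s j = s' j) → f k s = f k s') : ∃ s : ℕ → E, ∀ k, s k = f k s := by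
  let s : ℕ → E := fun k => Nat.strongRec (motive := fun _ => E)
    (fun k ih => f k fun j => if h : j < k then ih j h else default) k
  refine ⟨s, fun k => ?_⟩
  have hs : s k = f k fun j => if j < k then s j else default := by
    simp only [s]
    rw [Nat.strongRec_eq]
    rfl
  rw [hs]
  exact hf k _ _ fun j hj => if_pos hj

/-- An output signal that satisfies the system equations up to time `L` can be continued to a
trajectory, for any input and admissible scheduling signal. -/
theorem System.exists_isTrajectory (G : System nu ny np) (w : G.InitCond) (u : ℕ → Fin nu → ℝ)
    {p : ℕ → Fin np → ℝ} (hp : p ∈ G.Sched) (L : ℕ) (y₀ : ℕ → Fin ny → ℝ)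
    (h : ∀ k : ℤ, 1 ≤ k → k ≤ L →
      G.resid k (liftPair (prepend w.p p) (prepend w.u u) (prepend w.y y₀)) = 0) :
    ∃ y, G.IsTrajectory w u p y ∧ ∀ k < L, y k = y₀ k := by
  obtain ⟨y, hy⟩ := exists_causal_fixedPoint
    (fun (k : ℕ) (s : ℕ → Fin ny → ℝ) => if k < L then y₀ k else
      ∑ i : Fin (G.nb + 1), affine (G.b i) (prepend w.p p ((k : ℤ) + 1 - (i : ℕ))) *ᵥ
        prepend w.u u ((k : ℤ) + 1 - (i : ℕ)) -
      ∑ i : Fin G.na, affine (G.a i) (prepend w.p p ((k : ℤ) + 1 - ((i : ℕ) + 1))) *ᵥ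
        prepend w.y s ((k : ℤ) + 1 - ((i : ℕ) + 1))) (by
    intro k s s' hs
    split
    · rfl
    · congr 1
      refine Finset.sum_congr rfl fun i _ => ?_
      rw [prepend_congr w.y fun j hj => hs j (by omega)])
  have hyL : ∀ k < L, y k = y₀ k := fun k hk => by rw [hy k, if_pos hk]
  refine ⟨y, System.isTrajectory_iff.2 ⟨hp, fun k hk => ?_⟩, hyL⟩
  by_cases hkL : k ≤ L
  · rw [← h k hk hkL]
    refine G.resid_congr (fun i hi _ => ?_) fun i _ _ => rfl
    exact lift_congr rfl (prepend_congr w.y fun j hj => hyL j (by omega))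
  · obtain ⟨n, rfl⟩ : ∃ n : ℕ, k = (n : ℤ) + 1 := ⟨(k - 1).toNat, by omega⟩
    rw [System.resid_liftPair, prepend_of_pos, hy n, if_neg (by omega)]
    abel

/-! ### Windows of the data -/

theorem hankel_mulVec {m : Type} (h : L ≤ N) (x : Fin N → m → ℝ) (g : Fin (N - L + 1) → ℝ)
    (i : Fin L) (c : m) :
    (hankel h x *ᵥ g) (i, c) = ∑ j : Fin (N - L + 1), g j * x ⟨i + j, by omega⟩ c := by
  simp [Matrix.mulVec, dotProduct, hankel, mul_comm]

theorem schedBlock_mulVec (pbar : Fin L → Fin np → ℝ) (v : Fin L × Fin d → ℝ) (i : Fin L)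
    (m : Fin np) (c : Fin d) : (schedBlock d pbar *ᵥ v) (i, m, c) = pbar i m * v (i, c) := by
  simp [Matrix.mulVec, dotProduct, schedBlock, Fintype.sum_prod_type, Matrix.one_apply]

/-- On the null space of `F₂(p̄)`, the combination of the lifted data windows is the lift along `p̄`
of the combination of the data windows. -/
theorem sum_lift_window (h : L ≤ N) {p : Fin N → Fin np → ℝ} {x : Fin N → Fin d → ℝ}
    {pbar : Fin L → Fin np → ℝ} {g : Fin (N - L + 1) → ℝ}
    (hF : (hankel h (kronSeq p x) - schedBlock d pbar * hankel h x) *ᵥ g = 0)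
    {P P' : ℤ → Fin np → ℝ} {X X' : ℤ → Fin d → ℝ}
    (hP : ∀ k : Fin N, P ((k : ℕ) + 1) = p k) (hX : ∀ k : Fin N, X ((k : ℕ) + 1) = x k)
    (hP' : ∀ k : Fin L, P' ((k : ℕ) + 1) = pbar k)
    (hX' : ∀ (k : Fin L) c, X' ((k : ℕ) + 1) c = (hankel h x *ᵥ g) (k, c))
    {m : ℤ} (h1 : 1 ≤ m) (hm : m ≤ L) :
    ∑ j : Fin (N - L + 1), g j • lift (fun k => P (k + (j : ℕ))) (fun k => X (k + (j : ℕ))) m =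
      lift P' X' m := by
  obtain ⟨i, rfl⟩ : ∃ i : Fin L, m = ((i : ℕ) : ℤ) + 1 :=
    ⟨⟨(m - 1).toNat, by omega⟩, by simp; omega⟩
  have hPj : ∀ j : Fin (N - L + 1), P ((i : ℕ) + 1 + (j : ℕ)) = p ⟨i + j, by omega⟩ := fun j => by
    rw [← hP]; congr 1; push_cast; ring
  have hXj : ∀ j : Fin (N - L + 1), X ((i : ℕ) + 1 + (j : ℕ)) = x ⟨i + j, by omega⟩ := fun j => by
    rw [← hX]; congr 1; push_cast; ring
  funext q c
  simp only [lift, Finset.sum_apply, Pi.smul_apply, hPj, hXj, hP', hX', smul_eq_mul]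
  refine Fin.cases ?_ (fun q => ?_) q
  · simp [hankel_mulVec]
  · have := congrFun hF (i, q, c)
    rw [Matrix.sub_mulVec, ← Matrix.mulVec_mulVec, Pi.sub_apply, schedBlock_mulVec, hankel_mulVec,
      Pi.zero_apply, sub_eq_zero] at this
    simpa [kronSeq] using this

/-- The continuation of a vectorized sequence of length `L` by zero. -/
noncomputable def extend (v : Fin L × Fin d → ℝ) (k : ℕ) (c : Fin d) : ℝ :=
  if h : k < L then v (⟨k, h⟩, c) else 0

@[simp]
theorem extend_fin (v : Fin L × Fin d → ℝ) (k : Fin L) (c : Fin d) : extend v k c = v (k, c) := by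
  simp [extend]

/-! ### The data condition -/

theorem V_mulVec_eq_zero {ℓ : ℕ} (hℓ : ℓ ≤ L)
    {v : (Fin L × Fin nu) ⊕ (Fin L × Fin ny) → ℝ} :
    V ℓ L nu ny *ᵥ v = 0 ↔ ∀ i : Fin L, (i : ℕ) < ℓ →
      (∀ c, v (.inl (i, c)) = 0) ∧ ∀ c, v (.inr (i, c)) = 0 := by
  have key : ∀ (d : ℕ) (v : Fin L × Fin d → ℝ) (i : Fin ℓ) (c : Fin d),
      (firstSamples ℓ L d *ᵥ v) (i, c) = v (⟨i, by omega⟩, c) := fun d v i c => by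
    have : ∀ x : Fin L, (i : ℕ) = x ↔ (⟨i, by omega⟩ : Fin L) = x := fun x => by
      rw [Fin.ext_iff]
    simp [Matrix.mulVec, dotProduct, firstSamples, Fintype.sum_prod_type, this, ite_and]
  rw [V, Matrix.fromBlocks_mulVec]
  simp only [Matrix.zero_mulVec, add_zero, zero_add]
  constructor
  · intro h i hi
    exact ⟨fun c => by simpa [key] using congrFun h (.inl (⟨i, hi⟩, c)),
      fun c => by simpa [key] using congrFun h (.inr (⟨i, hi⟩, c))⟩
  · intro h
    funext r
    obtain ⟨i, c⟩ | ⟨i, c⟩ := r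
    · simpa [key] using (h ⟨i, by omega⟩ i.2).1 c
    · simpa [key] using (h ⟨i, by omega⟩ i.2).2 c

theorem dotProduct_PiL_mulVec (Q : Matrix (Fin nu) (Fin nu) ℝ) (S : Matrix (Fin nu) (Fin ny) ℝ)
    (R : Matrix (Fin ny) (Fin ny) ℝ) (v : (Fin L × Fin nu) ⊕ (Fin L × Fin ny) → ℝ) :
    v ⬝ᵥ (PiL L Q S R *ᵥ v) =
      ∑ k : Fin L, supply Q S R (fun c => v (.inl (k, c))) (fun c => v (.inr (k, c))) := by
  have key : ∀ {m n : ℕ} (M : Matrix (Fin m) (Fin n) ℝ) (x : Fin L × Fin n → ℝ) (k : Fin L) c,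
      (((1 : Matrix (Fin L) (Fin L) ℝ) ⊗ₖ M) *ᵥ x) (k, c) = (M *ᵥ fun c => x (k, c)) c := by
    intro m n M x k c
    simp [Matrix.mulVec, dotProduct, Fintype.sum_prod_type, Matrix.one_apply]
  simp only [PiL, supply, supplyMatrix, Matrix.fromBlocks_mulVec, dotProduct,
    Fintype.sum_sum_type, Fintype.sum_prod_type, Sum.elim_inl, Sum.elim_inr, Pi.add_apply, key,
    Finset.sum_add_distrib]
  rfl

theorem dotProduct_PiH_mulVec (h : L ≤ N) (u : Fin N → Fin nu → ℝ) (y : Fin N → Fin ny → ℝ)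
    (Q : Matrix (Fin nu) (Fin nu) ℝ) (S : Matrix (Fin nu) (Fin ny) ℝ)
    (R : Matrix (Fin ny) (Fin ny) ℝ) (g : Fin (N - L + 1) → ℝ) :
    g ⬝ᵥ (PiH h u y Q S R *ᵥ g) = ∑ k : Fin L, supply Q S R
      (fun c => (ioHankel h u y *ᵥ g) (.inl (k, c)))
      (fun c => (ioHankel h u y *ᵥ g) (.inr (k, c))) := by
  rw [← dotProduct_PiL_mulVec, PiH, ← Matrix.mulVec_mulVec, ← Matrix.mulVec_mulVec,
    Matrix.dotProduct_mulVec, Matrix.vecMul_transpose]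

theorem F_mulVec_eq_zero {ℓ : ℕ} (h : L ≤ N) {u : Fin N → Fin nu → ℝ} {p : Fin N → Fin np → ℝ}
    {y : Fin N → Fin ny → ℝ} {pbar : Fin L → Fin np → ℝ} {g : Fin (N - L + 1) → ℝ} :
    F ℓ h u p y pbar *ᵥ g = 0 ↔
      V ℓ L nu ny *ᵥ (ioHankel h u y *ᵥ g) = 0 ∧ F₂ h u p y pbar *ᵥ g = 0 := by
  rw [F, Matrix.fromRows_mulVec, Matrix.mulVec_mulVec]
  constructor
  · intro h
    exact ⟨funext fun i => congrFun h (.inl i), funext fun i => congrFun h (.inr i)⟩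
  · rintro ⟨h₁, h₂⟩
    rw [h₁, h₂]
    exact Sum.elim_zero_zero

theorem F₂_mulVec_eq_zero (h : L ≤ N) {u : Fin N → Fin nu → ℝ} {p : Fin N → Fin np → ℝ}
    {y : Fin N → Fin ny → ℝ} {pbar : Fin L → Fin np → ℝ} {g : Fin (N - L + 1) → ℝ}
    (hg : F₂ h u p y pbar *ᵥ g = 0) :
    (hankel h (kronSeq p u) - schedBlock nu pbar * hankel h u) *ᵥ g = 0 ∧
      (hankel h (kronSeq p y) - schedBlock ny pbar * hankel h y) *ᵥ g = 0 := by
  rw [F₂, Matrix.fromRows_mulVec] at hg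
  exact ⟨funext fun i => congrFun hg (.inl i), funext fun i => congrFun hg (.inr i)⟩

theorem ioHankel_mulVec (h : L ≤ N) (u : Fin N → Fin nu → ℝ) (y : Fin N → Fin ny → ℝ)
    (g : Fin (N - L + 1) → ℝ) :
    ioHankel h u y *ᵥ g = Sum.elim (hankel h u *ᵥ g) (hankel h y *ᵥ g) :=
  Matrix.fromRows_mulVec _ _ _

@[simp]
theorem supply_zero (Q : Matrix (Fin nu) (Fin nu) ℝ) (S : Matrix (Fin nu) (Fin ny) ℝ)
    (R : Matrix (Fin ny) (Fin ny) ℝ) : supply Q S R 0 0 = 0 := by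
  simp [supply]

/-! ### Combinations of data windows -/

/-- The pair of lifted signals that the data window starting after time `j` sees, including the
past of the window. -/
noncomputable def window (P : ℤ → Fin np → ℝ) (U : ℤ → Fin nu → ℝ) (Y : ℤ → Fin ny → ℝ) (j : ℕ) :
    (ℤ → Fin (np + 1) → Fin ny → ℝ) × (ℤ → Fin (np + 1) → Fin nu → ℝ) :=
  liftPair (fun k => P (k + j)) (fun k => U (k + j)) (fun k => Y (k + j))

/-- On the null space of `F₂(p̄)` and at the times `1, …, L`, the combination of the data windows is
the lift along `p̄` of an input and an output signal. -/
theorem sum_window (h : L ≤ N) {u : Fin N → Fin nu → ℝ} {p : Fin N → Fin np → ℝ}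
    {y : Fin N → Fin ny → ℝ} {pbar : Fin L → Fin np → ℝ} {g : Fin (N - L + 1) → ℝ}
    (hF : F₂ h u p y pbar *ᵥ g = 0) {P P' : ℤ → Fin np → ℝ} {U U' : ℤ → Fin nu → ℝ}
    {Y Y' : ℤ → Fin ny → ℝ} (hP : ∀ k : Fin N, P ((k : ℕ) + 1) = p k)
    (hU : ∀ k : Fin N, U ((k : ℕ) + 1) = u k) (hY : ∀ k : Fin N, Y ((k : ℕ) + 1) = y k)
    (hP' : ∀ k : Fin L, P' ((k : ℕ) + 1) = pbar k)
    (hU' : ∀ k : Fin L, U' ((k : ℕ) + 1) = extend (hankel h u *ᵥ g) k)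
    (hY' : ∀ k : Fin L, Y' ((k : ℕ) + 1) = extend (hankel h y *ᵥ g) k)
    {m : ℤ} (h1 : 1 ≤ m) (hm : m ≤ L) :
    (∑ j : Fin (N - L + 1), g j • window P U Y j).1 m = lift P' Y' m ∧
      (∑ j : Fin (N - L + 1), g j • window P U Y j).2 m = lift P' U' m := by
  obtain ⟨hFu, hFy⟩ := F₂_mulVec_eq_zero h hF
  simp only [Prod.fst_sum, Prod.snd_sum, Finset.sum_apply, Prod.smul_fst, Prod.smul_snd,
    Pi.smul_apply]
  exact ⟨sum_lift_window h hFy hP hY hP' (fun k c => by rw [hY', extend_fin]) h1 hm,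
    sum_lift_window h hFu hP hU hP' (fun k c => by rw [hU', extend_fin]) h1 hm⟩

namespace System

variable {G : System nu ny np}

theorem resid_window {w : G.InitCond} {u : ℕ → Fin nu → ℝ} {p : ℕ → Fin np → ℝ}
    {y : ℕ → Fin ny → ℝ} (ht : G.IsTrajectory w u p y) (j : ℕ) {k : ℤ} (hk : 1 ≤ k) :
    G.resid k (window (prepend w.p p) (prepend w.u u) (prepend w.y y) j) = 0 := by
  rw [← (isTrajectory_iff.1 ht).2 (k + j) (by omega)]
  refine G.resid_congr (fun i _ _ => ?_) fun i _ _ => ?_ <;>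
  exact lift_congr (congrArg _ (by ring)) (congrArg _ (by ring))

theorem prepend_mem {w : G.InitCond} {p : ℕ → Fin np → ℝ} (hp : p ∈ G.Sched) {k : ℤ}
    (hk : -(G.nr : ℤ) < k) : prepend w.p p k ∈ G.PSpace := by
  unfold prepend
  split
  · exact G.sched_mem p hp _
  · rw [dif_pos (by omega)]
    exact w.p_mem _

/-- The initial condition with zero past inputs and outputs and a constant past scheduling
signal. -/
def zeroInit (G : System nu ny np) {q : Fin np → ℝ} (hq : q ∈ G.PSpace) : G.InitCond :=
  ⟨0, fun _ => q, 0, fun _ => hq⟩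

theorem isZero_zeroInit {q : Fin np → ℝ} (hq : q ∈ G.PSpace) : (G.zeroInit hq).IsZero :=
  ⟨rfl, rfl⟩

/-- The combination of data windows satisfies the system equations at those times of
the window whose whole past of length `nr` lies in the window. If it vanishes at the first `ℓ ≥ nr`
times, it is therefore the beginning of a trajectory with zero initial condition. -/
theorem IsDissipative.dataCondition {Q : Matrix (Fin nu) (Fin nu) ℝ}
    {S : Matrix (Fin nu) (Fin ny) ℝ} {R : Matrix (Fin ny) (Fin ny) ℝ}
    (hdiss : G.IsDissipative L Q S R) (hL : 1 ≤ L) (h : L ≤ N) {u : Fin N → Fin nu → ℝ}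
    {p : Fin N → Fin np → ℝ} {y : Fin N → Fin ny → ℝ} (hdata : (u, p, y) ∈ G.behaviorOn N) {ℓ : ℕ}
    (hℓ : G.nr ≤ ℓ) (hℓL : ℓ < L) {pbar : Fin L → Fin np → ℝ} (hpbar : pbar ∈ G.schedOn L) :
    DataCondition ℓ h u p y Q S R pbar := by
  intro g hg
  obtain ⟨hV, hF⟩ := (F_mulVec_eq_zero h).1 hg
  rw [V_mulVec_eq_zero hℓL.le, ioHankel_mulVec] at hV
  simp only [Sum.elim_inl, Sum.elim_inr] at hV
  obtain ⟨⟨us, ps, ys⟩, ⟨wd, ht⟩, hs⟩ := hdata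
  dsimp only at ht hs
  obtain ⟨p', hp', hpp'⟩ := hpbar
  set U := extend (hankel h u *ᵥ g) with hU
  set Y := extend (hankel h y *ᵥ g) with hY
  set w := G.zeroInit (G.sched_mem p' hp' 0) with hw
  have hUz : ∀ k : ℤ, k ≤ ℓ → prepend w.u U k = 0 := fun k hk => by
    by_cases hk0 : k ≤ 0
    · exact prepend_eq_zero _ hk0
    obtain ⟨n, rfl⟩ : ∃ n : ℕ, k = (n : ℤ) + 1 := ⟨(k - 1).toNat, by omega⟩
    rw [prepend_of_pos]
    funext c
    exact (extend_fin (hankel h u *ᵥ g) ⟨n, by omega⟩ c).trans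
      ((hV ⟨n, by omega⟩ (by dsimp only; omega)).1 c)
  have hYz : ∀ k : ℤ, k ≤ ℓ → prepend w.y Y k = 0 := fun k hk => by
    by_cases hk0 : k ≤ 0
    · exact prepend_eq_zero _ hk0
    obtain ⟨n, rfl⟩ : ∃ n : ℕ, k = (n : ℤ) + 1 := ⟨(k - 1).toNat, by omega⟩
    rw [prepend_of_pos]
    funext c
    exact (extend_fin (hankel h y *ᵥ g) ⟨n, by omega⟩ c).trans
      ((hV ⟨n, by omega⟩ (by dsimp only; omega)).2 c)
  have hsum := fun (m : ℤ) => @sum_window _ _ _ _ _ h u p y pbar g hF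
    (prepend wd.p ps) (prepend w.p p') (prepend wd.u us) (prepend w.u U) (prepend wd.y ys)
    (prepend w.y Y) (fun k => by rw [prepend_of_pos, (hs k).2.1])
    (fun k => by rw [prepend_of_pos, (hs k).1]) (fun k => by rw [prepend_of_pos, (hs k).2.2])
    (fun k => by rw [prepend_of_pos, hpp']) (fun k => by rw [prepend_of_pos])
    (fun k => by rw [prepend_of_pos]) m
  obtain ⟨y', hy', hyL⟩ := G.exists_isTrajectory w U hp' L Y fun k hk hkL => by
    by_cases hkℓ : k ≤ ℓ
    · rw [G.resid_congr (t' := 0) (k' := k), map_zero]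
      · exact fun i hi _ => lift_eq_zero _ (hYz _ (by omega))
      · exact fun i hi _ => lift_eq_zero _ (hUz _ (by omega))
    · have hna : G.na ≤ ℓ := (le_max_left _ _).trans hℓ
      have hnb : G.nb ≤ ℓ := (le_max_right _ _).trans hℓ
      rw [G.resid_congr (k' := k) (t' := ∑ j : Fin (N - L + 1),
        g j • window (prepend wd.p ps) (prepend wd.u us) (prepend wd.y ys) j), map_sum]
      · refine Finset.sum_eq_zero fun j _ => ?_
        rw [map_smul, resid_window ht j hk, smul_zero]
      · exact fun i hi hin => (hsum _ (by omega) (by omega)).1.symm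
      · exact fun i hi hin => (hsum _ (by omega) (by omega)).2.symm
  have := hdiss w U p' y' (isZero_zeroInit _) hy' L hL le_rfl
  rw [Finset.sum_range] at this
  rw [dotProduct_PiH_mulVec, ioHankel_mulVec]
  refine this.trans_eq (Finset.sum_congr rfl fun k _ => ?_)
  rw [hyL k k.2]
  congr 1 <;> funext c <;> simp [hU, hY]

end System

/-! ### Trajectories of a state-space representation with a fixed scheduling signal -/

section StateSpace

variable {n : ℕ} (A : (Fin np → ℝ) → Matrix (Fin n) (Fin n) ℝ)
  (B : (Fin np → ℝ) → Matrix (Fin n) (Fin nu) ℝ) (C : (Fin np → ℝ) → Matrix (Fin ny) (Fin n) ℝ)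
  (D : (Fin np → ℝ) → Matrix (Fin ny) (Fin nu) ℝ) (p : ℕ → Fin np → ℝ) (L : ℕ)

/-- The input at time index `k` as a function of the input sequence of length `L`, which is
continued by zero. -/
def inputMap (nu L k : ℕ) : (Fin L × Fin nu → ℝ) →ₗ[ℝ] (Fin nu → ℝ) :=
  LinearMap.pi fun c => if h : k < L then LinearMap.proj (⟨k, h⟩, c) else 0

/-- The state at time index `k` as a function of the initial state and the input sequence. -/
noncomputable def stateMap : ℕ → ((Fin n → ℝ) × (Fin L × Fin nu → ℝ)) →ₗ[ℝ] (Fin n → ℝ)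
  | 0 => LinearMap.fst ℝ _ _
  | k + 1 => (A (p k)).mulVecLin ∘ₗ stateMap k +
      (B (p k)).mulVecLin ∘ₗ inputMap nu L k ∘ₗ LinearMap.snd ℝ _ _

/-- The map from the initial state and the input sequence of length `L` to the stacked input and
output sequences of length `L`. -/
noncomputable def ioMap : ((Fin n → ℝ) × (Fin L × Fin nu → ℝ)) →ₗ[ℝ]
    ((Fin L × Fin nu) ⊕ (Fin L × Fin ny) → ℝ) :=
  LinearMap.pi (Sum.elim (fun i => LinearMap.proj i ∘ₗ LinearMap.snd ℝ _ _)
    (fun i => LinearMap.proj i.2 ∘ₗ ((C (p i.1)).mulVecLin ∘ₗ stateMap A B p L i.1 +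
      (D (p i.1)).mulVecLin ∘ₗ inputMap nu L i.1 ∘ₗ LinearMap.snd ℝ _ _)))

theorem finrank_range_ioMap_le :
    Module.finrank ℝ (LinearMap.range (ioMap A B C D p L)) ≤ n + nu * L := by
  refine (LinearMap.finrank_range_le _).trans ?_
  simp [mul_comm]

end StateSpace

/-- The stacked input and output sequences of length `L`. -/
def stack (L : ℕ) (u : ℕ → Fin nu → ℝ) (y : ℕ → Fin ny → ℝ) :
    (Fin L × Fin nu) ⊕ (Fin L × Fin ny) → ℝ :=
  Sum.elim (fun i => u i.1 i.2) (fun i => y i.1 i.2)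

theorem System.IsRealizedBy.stack_mem_range {G : System nu ny np} {n : ℕ}
    {A : (Fin np → ℝ) → Matrix (Fin n) (Fin n) ℝ} {B : (Fin np → ℝ) → Matrix (Fin n) (Fin nu) ℝ}
    {C : (Fin np → ℝ) → Matrix (Fin ny) (Fin n) ℝ} {D : (Fin np → ℝ) → Matrix (Fin ny) (Fin nu) ℝ}
    (hr : G.IsRealizedBy n A B C D) {w : G.InitCond} {u : ℕ → Fin nu → ℝ} {p : ℕ → Fin np → ℝ}
    {y : ℕ → Fin ny → ℝ} (ht : G.IsTrajectory w u p y) (L : ℕ) :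
    stack L u y ∈ LinearMap.range (ioMap A B C D p L) := by
  obtain ⟨-, x, hx⟩ := (hr u p y).1 ⟨w, ht⟩
  have hin : ∀ k < L, inputMap nu L k (fun i => u i.1 i.2) = u k := fun k hk => by
    funext c
    simp [inputMap, hk]
  have hst : ∀ k ≤ L, stateMap A B p L k (x 0, fun i => u i.1 i.2) = x k := by
    intro k
    induction k with
    | zero => exact fun _ => rfl
    | succ k ih =>
      intro hk
      simp [stateMap, ih (by omega), hin k hk, (hx k).1]
  refine ⟨(x 0, fun i => u i.1 i.2), ?_⟩
  funext i
  obtain ⟨i, c⟩ | ⟨i, c⟩ := i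
  · rfl
  · simp [ioMap, stack, hst i i.2.le, hin i i.2, (hx i).2]

/-! ### Persistency of excitation -/

/-- Projecting the row space of a matrix `M` onto a subspace `K` gives a space of dimension at most
that of `M K`: on the projection, `M` is injective, because the projection is orthogonal to
`K ∩ ker M`. -/
theorem finrank_map_starProjection_le {ι κ : Type} [Fintype κ] [Fintype ι] (M : Matrix ι κ ℝ)
    (K : Submodule ℝ (EuclideanSpace ℝ κ)) :
    Module.finrank ℝ ((Submodule.span ℝ (Set.range fun r => WithLp.toLp 2 (M r))).map
      (K.starProjection : EuclideanSpace ℝ κ →ₗ[ℝ] EuclideanSpace ℝ κ)) ≤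
    Module.finrank ℝ (K.map (M.mulVecLin ∘ₗ (WithLp.linearEquiv 2 ℝ (κ → ℝ)).toLinearMap)) := by
  set T := M.mulVecLin ∘ₗ (WithLp.linearEquiv 2 ℝ (κ → ℝ)).toLinearMap with hT
  set W := (Submodule.span ℝ (Set.range fun r => WithLp.toLp 2 (M r))).map
      (K.starProjection : EuclideanSpace ℝ κ →ₗ[ℝ] EuclideanSpace ℝ κ) with hW
  have hWK : W ≤ K := by
    rintro _ ⟨v, -, rfl⟩
    exact K.starProjection_apply_mem v
  have horth : ∀ z ∈ K, T z = 0 → ∀ v ∈ W, inner ℝ v z = 0 := by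
    rintro z hz hTz _ ⟨v, hv, rfl⟩
    have hz' : K.starProjection z = z := Submodule.starProjection_eq_self_iff.2 hz
    have : inner ℝ v z = 0 := by
      induction hv using Submodule.span_induction with
      | mem v hv =>
        obtain ⟨r, rfl⟩ := hv
        have := congrFun hTz r
        rw [EuclideanSpace.inner_eq_star_dotProduct]
        simpa [hT, Matrix.mulVec, dotProduct_comm] using this
      | zero => exact inner_zero_left _
      | add a b _ _ ha hb => rw [inner_add_left, ha, hb, add_zero]
      | smul c a _ ha => rw [inner_smul_left, ha, mul_zero]
    calc inner ℝ (K.starProjection v) z = inner ℝ v (K.starProjection z) :=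
          Submodule.inner_starProjection_left_eq_right K v z
      _ = 0 := by rw [hz', this]
  have hinj : Function.Injective (T.domRestrict W) := by
    rw [← LinearMap.ker_eq_bot, LinearMap.ker_eq_bot']
    rintro ⟨v, hv⟩ h
    exact Subtype.ext (inner_self_eq_zero.1 (horth v (hWK hv) h v hv))
  rw [← LinearMap.finrank_range_of_inj hinj, LinearMap.range_domRestrict]
  exact Submodule.finrank_mono (Submodule.map_mono hWK)

namespace System

variable {G : System nu ny np}

/-- The combinations of data windows that are compatible with `p̄` are beginnings of trajectories.
A single initial condition need not produce the combination of the pasts of the windows, since these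
have different scheduling signals. But the past of each window is the initial condition of a
trajectory along `p̄`; after subtracting these trajectories, the past of the combination vanishes,
and the space of trajectories along `p̄` is a linear space because of the state-space
representation. -/
theorem IsRealizedBy.ioHankel_mulVec_mem_range {n : ℕ}
    {A : (Fin np → ℝ) → Matrix (Fin n) (Fin n) ℝ} {B : (Fin np → ℝ) → Matrix (Fin n) (Fin nu) ℝ}
    {C : (Fin np → ℝ) → Matrix (Fin ny) (Fin n) ℝ} {D : (Fin np → ℝ) → Matrix (Fin ny) (Fin nu) ℝ}
    (hr : G.IsRealizedBy n A B C D) (h : L ≤ N) {u : Fin N → Fin nu → ℝ}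
    {p : Fin N → Fin np → ℝ} {y : Fin N → Fin ny → ℝ} (hdata : (u, p, y) ∈ G.behaviorOn N)
    {p' : ℕ → Fin np → ℝ} (hp' : p' ∈ G.Sched) {g : Fin (N - L + 1) → ℝ}
    (hF : F₂ h u p y (fun k => p' k) *ᵥ g = 0) :
    ioHankel h u y *ᵥ g ∈ LinearMap.range (ioMap A B C D p' L) := by
  obtain ⟨⟨us, ps, ys⟩, ⟨wd, ht⟩, hs⟩ := hdata
  dsimp only at ht hs
  set P := prepend wd.p ps with hPdef
  set w := G.zeroInit (G.sched_mem p' hp' 0)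
  -- The past of each data window, followed by zero input along `p'`, gives the trajectory `v j`.
  let wj : Fin (N - L + 1) → G.InitCond := fun j =>
    ⟨fun i => prepend wd.u us (-(i : ℕ) + (j : ℕ)), fun i => P (-(i : ℕ) + (j : ℕ)),
      fun i => prepend wd.y ys (-(i : ℕ) + (j : ℕ)), fun i => prepend_mem ht.1 (by omega)⟩
  have hex : ∀ j, ∃ v, G.IsTrajectory (wj j) 0 p' v := fun j =>
    let ⟨v, hv, _⟩ := G.exists_isTrajectory (wj j) 0 hp' 0 0 (by intro k _ _; omega)
    ⟨v, hv⟩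
  choose v hv using hex
  set U := extend (hankel h u *ᵥ g) with hU
  set Y := extend (hankel h y *ᵥ g) with hY
  have hsum := fun (m : ℤ) => @sum_window _ _ _ _ _ h u p y (fun k => p' k) g hF
    P (prepend w.p p') (prepend wd.u us) (prepend w.u U) (prepend wd.y ys)
    (prepend w.y Y) (fun k => by rw [hPdef, prepend_of_pos, (hs k).2.1])
    (fun k => by rw [prepend_of_pos, (hs k).1]) (fun k => by rw [prepend_of_pos, (hs k).2.2])
    (fun k => by rw [prepend_of_pos]) (fun k => by rw [prepend_of_pos])
    (fun k => by rw [prepend_of_pos]) m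
  obtain ⟨y', hy', hyL⟩ := G.exists_isTrajectory w U hp' L
    (fun k => Y k - ∑ j, g j • v j k) fun k hk hkL => by
      rw [G.resid_congr (k' := k)
        (t' := ∑ j, g j • window P (prepend wd.u us) (prepend wd.y ys) j -
          ∑ j, g j • liftPair (prepend (wj j).p p') (prepend (wj j).u 0) (prepend (wj j).y (v j))),
        map_sub, map_sum, map_sum, Finset.sum_eq_zero, Finset.sum_eq_zero, sub_zero]
      · intro j _
        rw [map_smul, (isTrajectory_iff.1 (hv j)).2 k hk, smul_zero]
      · intro j _
        rw [map_smul, resid_window ht j hk, smul_zero]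
      · intro i hi hin
        have hnr : G.na ≤ G.nr := le_max_left _ _
        generalize hm : k - i = m
        by_cases hm0 : m ≤ 0
        · obtain ⟨q, rfl⟩ : ∃ q : Fin G.na, m = -((q : ℕ) : ℤ) :=
            ⟨⟨(-m).toNat, by omega⟩, by dsimp only; omega⟩
          refine (lift_eq_zero _ (prepend_eq_zero _ hm0)).trans ?_
          simp only [Prod.fst_sub, Prod.fst_sum, Pi.sub_apply, Finset.sum_apply, Prod.smul_fst,
            Pi.smul_apply]
          refine (sub_eq_zero.2 (Finset.sum_congr rfl fun j _ => congrArg _ ?_)).symm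
          refine lift_congr ?_ ?_
          · exact (prepend_of_nonpos (wj j).p p' ⟨q, by omega⟩).symm
          · exact (prepend_of_nonpos (wj j).y (v j) q).symm
        · rw [Prod.fst_sub, Pi.sub_apply, (hsum m (by omega) (by omega)).1]
          obtain ⟨n, rfl⟩ : ∃ n : ℕ, m = (n : ℤ) + 1 := ⟨(m - 1).toNat, by omega⟩
          simp only [Prod.fst_sum, Finset.sum_apply, Prod.smul_fst, Pi.smul_apply, liftPair]
          funext q c
          simp [lift, prepend_of_pos, Finset.mul_sum, mul_sub, mul_left_comm]
      · intro i hi hin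
        have hnr : G.nb ≤ G.nr := le_max_right _ _
        generalize hm : k - i = m
        by_cases hm0 : m ≤ 0
        · obtain ⟨q, rfl⟩ : ∃ q : Fin G.nb, m = -((q : ℕ) : ℤ) :=
            ⟨⟨(-m).toNat, by omega⟩, by dsimp only; omega⟩
          refine (lift_eq_zero _ (prepend_eq_zero _ hm0)).trans ?_
          simp only [Prod.snd_sub, Prod.snd_sum, Pi.sub_apply, Finset.sum_apply, Prod.smul_snd,
            Pi.smul_apply]
          refine (sub_eq_zero.2 (Finset.sum_congr rfl fun j _ => congrArg _ ?_)).symm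
          refine lift_congr ?_ ?_
          · exact (prepend_of_nonpos (wj j).p p' ⟨q, by omega⟩).symm
          · exact (prepend_of_nonpos (wj j).u 0 q).symm
        · rw [Prod.snd_sub, Pi.sub_apply, (hsum m (by omega) (by omega)).2]
          obtain ⟨n, rfl⟩ : ∃ n : ℕ, m = (n : ℤ) + 1 := ⟨(m - 1).toNat, by omega⟩
          simp only [Prod.snd_sum, Finset.sum_apply, Prod.smul_snd, Pi.smul_apply, liftPair]
          funext q c
          simp [lift, prepend_of_pos]
  have hdecomp : ioHankel h u y *ᵥ g =
      stack L U y' + ∑ j, g j • stack L (0 : ℕ → Fin nu → ℝ) (v j) := by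
    rw [ioHankel_mulVec]
    funext i
    obtain ⟨i, c⟩ | ⟨i, c⟩ := i
    · simp [stack, hU]
    · simp [stack, hyL i i.2, hY]
  rw [hdecomp]
  exact add_mem (hr.stack_mem_range hy' L)
    (sum_mem fun j _ => Submodule.smul_mem _ _ (hr.stack_mem_range (hv j) L))

/-- Persistently exciting data generate all trajectories of length `L`. -/
theorem IsRealizedBy.exists_ioHankel_mulVec_eq_stack {n : ℕ}
    {A : (Fin np → ℝ) → Matrix (Fin n) (Fin n) ℝ} {B : (Fin np → ℝ) → Matrix (Fin n) (Fin nu) ℝ}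
    {C : (Fin np → ℝ) → Matrix (Fin ny) (Fin n) ℝ} {D : (Fin np → ℝ) → Matrix (Fin ny) (Fin nu) ℝ}
    (hr : G.IsRealizedBy n A B C D) (h : L ≤ N) {u : Fin N → Fin nu → ℝ}
    {p : Fin N → Fin np → ℝ} {y : Fin N → Fin ny → ℝ} (hdata : (u, p, y) ∈ G.behaviorOn N)
    (hpe : IsPersistentlyExciting G n h u p y) {w : G.InitCond} {u' : ℕ → Fin nu → ℝ}
    {p' : ℕ → Fin np → ℝ} {y' : ℕ → Fin ny → ℝ} (ht : G.IsTrajectory w u' p' y') :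
    ∃ g, F₂ h u p y (fun k => p' k) *ᵥ g = 0 ∧ ioHankel h u y *ᵥ g = stack L u' y' := by
  set T := (ioHankel h u y).mulVecLin ∘ₗ
    (WithLp.linearEquiv 2 ℝ (Fin (N - L + 1) → ℝ)).toLinearMap with hT
  have hmem : ∀ x ∈ nullSpace h u p y (fun k => p' k),
      F₂ h u p y (fun k => p' k) *ᵥ (WithLp.ofLp x) = 0 := fun x hx => by
    simpa using congrArg WithLp.ofLp (LinearMap.mem_ker.1 hx)
  have hle : (nullSpace h u p y (fun k => p' k)).map T ≤
      LinearMap.range (ioMap A B C D p' L) := by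
    rintro _ ⟨x, hx, rfl⟩
    exact hr.ioHankel_mulVec_mem_range h hdata ht.1 (hmem x hx)
  have heq := Submodule.eq_of_le_of_finrank_le hle <|
    (finrank_range_ioMap_le A B C D p' L).trans <|
      (hpe (fun k => p' k) ⟨p', ht.1, fun _ => rfl⟩).symm.le.trans <|
        finrank_map_starProjection_le (ioHankel h u y) _
  obtain ⟨x, hx, hxs⟩ := heq ▸ hr.stack_mem_range ht L
  exact ⟨WithLp.ofLp x, hmem x hx, hxs⟩

/-! ### Trajectories preceded by zeros -/

theorem SchedSubsetShift.exists_shift (hG : G.SchedSubsetShift) {p : ℕ → Fin np → ℝ}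
    (hp : p ∈ G.Sched) (m : ℕ) : ∃ p' ∈ G.Sched, ∀ k, p' (k + m) = p k := by
  induction m with
  | zero => exact ⟨p, hp, fun _ => rfl⟩
  | succ m ih =>
    obtain ⟨p₁, h₁, hp₁⟩ := ih
    obtain ⟨p₂, h₂, hp₂⟩ := hG p₁ h₁
    exact ⟨p₂, h₂, fun k => by rw [← hp₁, ← hp₂]; rfl⟩

/-- The signal `s` preceded by `m` zeros. -/
def delay (m : ℕ) (s : ℕ → Fin d → ℝ) (k : ℕ) : Fin d → ℝ :=
  if k < m then 0 else s (k - m)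

theorem prepend_delay {n : ℕ} (m : ℕ) (s : ℕ → Fin d → ℝ) (k : ℤ) :
    prepend (0 : Fin n → Fin d → ℝ) (delay m s) k =
      prepend (0 : Fin n → Fin d → ℝ) s (k - m) := by
  by_cases hk : k ≤ m
  · rw [prepend_eq_zero s (by omega)]
    by_cases hk0 : k ≤ 0
    · exact prepend_eq_zero _ hk0
    · rw [prepend, if_pos (by omega), delay, if_pos (by omega)]
  · rw [prepend, if_pos (by omega), delay, if_neg (by omega), prepend, if_pos (by omega)]
    congr 1
    omega

/-- A trajectory with zero initial condition may be preceded by any number of zeros. -/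
theorem IsTrajectory.delay {w : G.InitCond} (hw : w.IsZero) {u : ℕ → Fin nu → ℝ}
    {p : ℕ → Fin np → ℝ} {y : ℕ → Fin ny → ℝ} (ht : G.IsTrajectory w u p y) {m : ℕ}
    {p' : ℕ → Fin np → ℝ} (hp' : p' ∈ G.Sched) (hpp' : ∀ k, p' (k + m) = p k) :
    G.IsTrajectory (G.zeroInit (G.sched_mem p' hp' 0)) (System.delay m u) p'
      (System.delay m y) := by
  obtain ⟨hwu, hwy⟩ := hw
  rw [isTrajectory_iff] at ht ⊢
  rw [hwu, hwy] at ht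
  have key : ∀ {d n : ℕ} (s : ℕ → Fin d → ℝ) (k : ℤ),
      lift (prepend (G.zeroInit (G.sched_mem p' hp' 0)).p p')
        (prepend (0 : Fin n → Fin d → ℝ) (System.delay m s)) k =
      lift (prepend w.p p) (prepend (0 : Fin n → Fin d → ℝ) s) (k - m) := by
    intro d n s k
    by_cases hk : k ≤ m
    · rw [lift_eq_zero _ (prepend_eq_zero s (by omega)),
        lift_eq_zero _ ((prepend_delay m s k).trans (prepend_eq_zero s (by omega)))]
    · refine lift_congr ?_ (prepend_delay m s k)
      obtain ⟨i, rfl⟩ : ∃ i : ℕ, k = ((i + m : ℕ) : ℤ) + 1 := ⟨(k - m - 1).toNat, by omega⟩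
      rw [prepend_of_pos, hpp', show (((i + m : ℕ) : ℤ) + 1 - m) = (i : ℤ) + 1 by push_cast; ring,
        prepend_of_pos]
  refine ⟨hp', fun k hk => ?_⟩
  by_cases hkm : k ≤ m
  · rw [G.resid_congr (t' := 0) (k' := k), map_zero]
    · exact fun i _ _ => (key y _).trans (lift_eq_zero _ (prepend_eq_zero y (by omega)))
    · exact fun i _ _ => (key u _).trans (lift_eq_zero _ (prepend_eq_zero u (by omega)))
  · rw [← ht.2 (k - m) (by omega)]
    refine G.resid_congr (fun i _ _ => (key y _).trans ?_) fun i _ _ => (key u _).trans ?_ <;>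
    exact congrArg _ (by ring)

/-- A trajectory of length `r ≤ L - ℓ` with zero initial condition is preceded by `L - r ≥ ℓ` zeros;
the resulting trajectory of length `L` has the same total supply and is generated by the data. -/
theorem IsRealizedBy.isDissipative {n : ℕ}
    {A : (Fin np → ℝ) → Matrix (Fin n) (Fin n) ℝ} {B : (Fin np → ℝ) → Matrix (Fin n) (Fin nu) ℝ}
    {C : (Fin np → ℝ) → Matrix (Fin ny) (Fin n) ℝ} {D : (Fin np → ℝ) → Matrix (Fin ny) (Fin nu) ℝ}
    (hr : G.IsRealizedBy n A B C D) (hG : G.SchedSubsetShift) (h : L ≤ N)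
    {u : Fin N → Fin nu → ℝ} {p : Fin N → Fin np → ℝ} {y : Fin N → Fin ny → ℝ}
    (hdata : (u, p, y) ∈ G.behaviorOn N) (hpe : IsPersistentlyExciting G n h u p y)
    {Q : Matrix (Fin nu) (Fin nu) ℝ} {S : Matrix (Fin nu) (Fin ny) ℝ}
    {R : Matrix (Fin ny) (Fin ny) ℝ} {ℓ : ℕ} (hℓ : ℓ < L)
    (hcond : ∀ pbar ∈ G.schedOn L, DataCondition ℓ h u p y Q S R pbar) :
    G.IsDissipative (L - ℓ) Q S R := by
  intro w u₁ p₁ y₁ hw ht r _ hrL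
  obtain ⟨m, rfl⟩ : ∃ m, L = m + r := ⟨L - r, by omega⟩
  obtain ⟨p', hp', hpp'⟩ := hG.exists_shift ht.1 m
  obtain ⟨g, hgF, hgs⟩ := hr.exists_ioHankel_mulVec_eq_stack h hdata hpe (ht.delay hw hp' hpp')
  have hV : V ℓ (m + r) nu ny *ᵥ (ioHankel h u y *ᵥ g) = 0 := by
    rw [hgs, V_mulVec_eq_zero hℓ.le]
    intro i hi
    have him : (i : ℕ) < m := by omega
    constructor <;> intro c <;> simp [stack, System.delay, him]
  have hsum := hcond _ ⟨p', hp', fun _ => rfl⟩ g ((F_mulVec_eq_zero h).2 ⟨hV, hgF⟩)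
  rw [dotProduct_PiH_mulVec, hgs] at hsum
  change 0 ≤ ∑ k : Fin (m + r), supply Q S R (System.delay m u₁ k) (System.delay m y₁ k) at hsum
  rw [← Finset.sum_range (fun k => supply Q S R (System.delay m u₁ k) (System.delay m y₁ k)),
    Finset.sum_range_add, Finset.sum_eq_zero, zero_add] at hsum
  · simpa [System.delay] using hsum
  · intro k hk
    simp [System.delay, Finset.mem_range.1 hk]

end System

end LPV

theorem theorem1 {nu ny np : ℕ} (G : LPV.System nu ny np)
    (Q : Matrix (Fin nu) (Fin nu) ℝ) (S : Matrix (Fin nu) (Fin ny) ℝ)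
    (R : Matrix (Fin ny) (Fin ny) ℝ) (hQ : Q.IsSymm) (hR : R.IsSymm)
    {N L : ℕ} (hL : 1 ≤ L) (hLN : L ≤ N)
    (u : Fin N → Fin nu → ℝ) (p : Fin N → Fin np → ℝ) (y : Fin N → Fin ny → ℝ)
    (hdata : (u, p, y) ∈ G.behaviorOn N) :
    (G.IsDissipative L Q S R →
      ∀ ℓ : ℕ, G.nr ≤ ℓ → ℓ < L → ∀ pbar ∈ G.schedOn L,
        LPV.DataCondition ℓ hLN u p y Q S R pbar) ∧
    (G.SchedSubsetShift →
      ∀ nx : ℕ, G.IsOrder nx → LPV.IsPersistentlyExciting G nx hLN u p y →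
        ∀ ℓ : ℕ, ℓ < L →
          (∀ pbar ∈ G.schedOn L, LPV.DataCondition ℓ hLN u p y Q S R pbar) →
            G.IsDissipative (L - ℓ) Q S R) := by
  constructor
  · intro hdiss ℓ hℓ hℓL pbar hpbar
    exact hdiss.dataCondition hL hLN hdata hℓ hℓL hpbar
  · rintro hG nx ⟨⟨A, B, C, D, hr⟩, -⟩ hpe ℓ hℓ hcond
    exact hr.isDissipative hG hLN hdata hpe hℓ hcond
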